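/- Let $N>0$ (noise variance) and $P\ge 0$ (power budget). Let $h_1,h_2,g\in\mathbb R^2$ be unit vectors with $h_1\perp h_2$ and $g\perp h_{1,2}:=(h_1+h_2)/\sqrt2$; here $h_1,h_2$ are the two possible channels of user 1 and $g$ is the channel of user 2. For powers $P_u,P_v\ge 0$ and unit vectors (beams) $B_u,B_v\in\mathbb R^2$ write $h_{j,u}=\langle h_j,B_u\rangle$, $h_{j,v}=\langle h_j,B_v\rangle$, $g_u=\langle g,B_u\rangle$, $g_v=\langle g,B_v\rangle$, and $$\beta_j=\frac{P_u h_{j,u}h_{j,v}}{h_{j,u}^2P_u+N},\qquad I_j=\frac{P_v}{P_u}\,\frac{(h_{j,u}^2P_u+N)^2}{h_{j,u}^2P_u+h_{j,v}^2P_v+N}$$ (with $I_j=0$ if $P_u=0$). Let $\mathcal R_1(B_u,B_v,P_u,P_v)$ be the set of $(R_1,R_2)\in\mathbb R_+^2$ with $$R_1\le\max_{\alpha\in\mathbb R}\min_{j\in\{1,2\}}\tfrac12\log_2\frac{h_{j,u}^2P_u+N}{I_j(\alpha-\beta_j)^2+N},\qquad R_2\le\tfrac12\log_2\frac{g_u^2P_u+g_v^2P_v+N}{g_u^2P_u+N},$$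 and let $\mathcal R_2(B_u,B_v,P_u,P_v)$ be the set of $(R_1,R_2)\in\mathbb R_+^2$ with $$R_1\le\min_{j\in\{1,2\}}\tfrac12\log_2\frac{h_{j,u}^2P_u+h_{j,v}^2P_v+N}{h_{j,v}^2P_v+N},\qquad R_2\le\tfrac12\log_2\frac{g_v^2P_v+N}{N}.$$ The CD-DPC (common description, dirty-paper coding) inner bound is $$\mathcal R_{\mathrm{CD}}=\bigcup_{\substack{P_u,P_v\ge0\\P_u+P_v\le P}}\ \bigcup_{\|B_u\|=\|B_v\|=1}\bigl[\mathcal R_1(B_u,B_v,P_u,P_v)\cup\mathcal R_2(B_u,B_v,P_u,P_v)\bigr].$$ Then $\mathcal R_{\mathrm{CD}}$ has the closed form $$\mathcal R_{\mathrm{CD}}=\bigcup_{\substack{P_u,P_v\ge0\\P_u+P_v\le P}}\ \bigcup_{\eta\in[-1,1]}\Bigl\{(R_1,R_2)\in\mathbb R_+^2:\ R_1\le\tfrac12\log_2\frac{P_u+2N}{P(\eta)+2N},\ \ R_2\le\tfrac12\log_2\frac{(1-\eta)P_v+2N}{2N}\Bigr\},$$ $$P(\eta)=\frac{(1-\eta)P_vP_u}{P+2N+\sqrt{(P+2N)^2+(\eta^2-1)P_v^2}},$$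 and the same equality holds with the union on the right restricted to $P_u+P_v=P$. Moreover beamforming along the mean channel is optimal: $\mathcal R_{\mathrm{CD}}$ is unchanged if $B_u$ is restricted to $B_u=h_{1,2}$ in its definition. -/

import Mathlib

noncomputable section

namespace CompoundMISO

/-- Real two-dimensional vectors (the transmitter has two antennas), with the Euclidean norm. -/
abbrev Vec := EuclideanSpace ℝ (Fin 2)

/-- `β = P_u h_u h_v / (h_u² P_u + N)`, where `h_u = ⟨h, B_u⟩` and `h_v = ⟨h, B_v⟩`. -/
def dpcBeta (N Pu : ℝ) (h Bu Bv : Vec) : ℝ :=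
  Pu * inner ℝ h Bu * inner ℝ h Bv / ((inner ℝ h Bu) ^ 2 * Pu + N)

/-- `I = (P_v / P_u) (h_u² P_u + N)² / (h_u² P_u + h_v² P_v + N)`. For `P_u = 0` it is `0` here,
and then `dpcRate` is `0`, the rate of a description that carries no power. -/
def dpcI (N Pu Pv : ℝ) (h Bu Bv : Vec) : ℝ :=
  Pv / Pu * (((inner ℝ h Bu) ^ 2 * Pu + N) ^ 2 /
    ((inner ℝ h Bu) ^ 2 * Pu + (inner ℝ h Bv) ^ 2 * Pv + N))

/-- The rate `½ log₂ ((h_u² P_u + N) / (I (α - β)² + N))` that dirty-paper coding with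
parameter `α` gives to the first user over the channel `h`. -/
def dpcRate (N Pu Pv : ℝ) (h Bu Bv : Vec) (α : ℝ) : ℝ :=
  1 / 2 * Real.logb 2 (((inner ℝ h Bu) ^ 2 * Pu + N) /
    (dpcI N Pu Pv h Bu Bv * (α - dpcBeta N Pu h Bu Bv) ^ 2 + N))

/-- First corner point: the codeword of user 1 is dirty-paper coded against that of user 2.
Here `h₁`, `h₂` are the two possible channels of user 1, and `g` is the channel of user 2. -/
def regionOne (h₁ h₂ g : Vec) (N : ℝ) (Bu Bv : Vec) (Pu Pv : ℝ) : Set (ℝ × ℝ) :=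
  {R | 0 ≤ R.1 ∧ 0 ≤ R.2 ∧
    R.1 ≤ ⨆ α : ℝ, min (dpcRate N Pu Pv h₁ Bu Bv α) (dpcRate N Pu Pv h₂ Bu Bv α) ∧
    R.2 ≤ 1 / 2 * Real.logb 2
      (((inner ℝ g Bu) ^ 2 * Pu + (inner ℝ g Bv) ^ 2 * Pv + N) / ((inner ℝ g Bu) ^ 2 * Pu + N))}

/-- The rate `½ log₂ ((h_u² P_u + h_v² P_v + N) / (h_v² P_v + N))`. -/
def interferedRate (N Pu Pv : ℝ) (h Bu Bv : Vec) : ℝ :=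
  1 / 2 * Real.logb 2
    (((inner ℝ h Bu) ^ 2 * Pu + (inner ℝ h Bv) ^ 2 * Pv + N) / ((inner ℝ h Bv) ^ 2 * Pv + N))

/-- Second corner point: the codeword of user 2 is dirty-paper coded against that of user 1. -/
def regionTwo (h₁ h₂ g : Vec) (N : ℝ) (Bu Bv : Vec) (Pu Pv : ℝ) : Set (ℝ × ℝ) :=
  {R | 0 ≤ R.1 ∧ 0 ≤ R.2 ∧
    R.1 ≤ min (interferedRate N Pu Pv h₁ Bu Bv) (interferedRate N Pu Pv h₂ Bu Bv) ∧
    R.2 ≤ 1 / 2 * Real.logb 2 (((inner ℝ g Bv) ^ 2 * Pv + N) / N)}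

/-- The common-description dirty-paper-coding (CD-DPC) inner bound: the union of both corner
regions over all power splits and all unit-norm beams. -/
def cdRegion (h₁ h₂ g : Vec) (N P : ℝ) : Set (ℝ × ℝ) :=
  {R | ∃ Pu Pv : ℝ, 0 ≤ Pu ∧ 0 ≤ Pv ∧ Pu + Pv ≤ P ∧
    ∃ Bu Bv : Vec, ‖Bu‖ = 1 ∧ ‖Bv‖ = 1 ∧
      R ∈ regionOne h₁ h₂ g N Bu Bv Pu Pv ∪ regionTwo h₁ h₂ g N Bu Bv Pu Pv}

/-- The part of the CD-DPC inner bound in which the beam of user 1 is a given vector `Bu`. -/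
def cdRegionAlong (h₁ h₂ g : Vec) (N P : ℝ) (Bu : Vec) : Set (ℝ × ℝ) :=
  {R | ∃ Pu Pv : ℝ, 0 ≤ Pu ∧ 0 ≤ Pv ∧ Pu + Pv ≤ P ∧
    ∃ Bv : Vec, ‖Bv‖ = 1 ∧
      R ∈ regionOne h₁ h₂ g N Bu Bv Pu Pv ∪ regionTwo h₁ h₂ g N Bu Bv Pu Pv}

/-- `(h₁ + h₂) / √2`. -/
def meanChannel (h₁ h₂ : Vec) : Vec := (1 / Real.sqrt 2) • (h₁ + h₂)

/-- `P(η) = (1 - η) P_v P_u / (P + 2N + √((P + 2N)² + (η² - 1) P_v²))`. -/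
def Peta (N P Pu Pv η : ℝ) : ℝ :=
  (1 - η) * Pv * Pu /
    (P + 2 * N + Real.sqrt ((P + 2 * N) ^ 2 + (η ^ 2 - 1) * Pv ^ 2))

/-- The closed-form rate pairs for given powers and a given `η`. -/
def closedRegion (N P Pu Pv η : ℝ) : Set (ℝ × ℝ) :=
  {R | 0 ≤ R.1 ∧ 0 ≤ R.2 ∧
    R.1 ≤ 1 / 2 * Real.logb 2 ((Pu + 2 * N) / (Peta N P Pu Pv η + 2 * N)) ∧
    R.2 ≤ 1 / 2 * Real.logb 2 (((1 - η) * Pv + 2 * N) / (2 * N))}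

theorem dpcI_nonneg {N Pu Pv : ℝ} (hN : 0 < N) (hu : 0 ≤ Pu) (hv : 0 ≤ Pv) (h Bu Bv : Vec) :
    0 ≤ dpcI N Pu Pv h Bu Bv := by
  unfold dpcI; positivity

theorem dpcRate_mono {N Pu Pv : ℝ} (hN : 0 < N) (hu : 0 ≤ Pu) (hv : 0 ≤ Pv) (h Bu Bv : Vec)
    {a b : ℝ} (hab : (a - dpcBeta N Pu h Bu Bv) ^ 2 ≤ (b - dpcBeta N Pu h Bu Bv) ^ 2) :
    dpcRate N Pu Pv h Bu Bv b ≤ dpcRate N Pu Pv h Bu Bv a := by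
  have hI := dpcI_nonneg hN hu hv h Bu Bv
  have h1 : 0 < (inner ℝ h Bu) ^ 2 * Pu + N := by positivity
  have h2 : 0 < dpcI N Pu Pv h Bu Bv * (a - dpcBeta N Pu h Bu Bv) ^ 2 + N := by positivity
  have h3 : 0 < dpcI N Pu Pv h Bu Bv * (b - dpcBeta N Pu h Bu Bv) ^ 2 + N := by positivity
  unfold dpcRate
  have := mul_le_mul_of_nonneg_left hab hI
  gcongr
  norm_num

theorem dpcRate_continuous {N Pu Pv : ℝ} (hN : 0 < N) (hu : 0 ≤ Pu) (hv : 0 ≤ Pv)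
    (h Bu Bv : Vec) : Continuous (dpcRate N Pu Pv h Bu Bv) := by
  have hI := dpcI_nonneg hN hu hv h Bu Bv
  have h1 : 0 < (inner ℝ h Bu) ^ 2 * Pu + N := by positivity
  have h2 : ∀ a : ℝ, 0 < dpcI N Pu Pv h Bu Bv * (a - dpcBeta N Pu h Bu Bv) ^ 2 + N :=
    fun a => by positivity
  unfold dpcRate Real.logb
  refine continuous_const.mul (Continuous.div_const (Continuous.log ?_ ?_) _)
  · exact continuous_const.div (by fun_prop) (fun a => (h2 a).ne')
  · exact fun a => (div_pos h1 (h2 a)).ne'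

/-- The supremum over `α` in `regionOne` is a maximum. -/
theorem exists_max_dpcRate {N Pu Pv : ℝ} (hN : 0 < N) (hu : 0 ≤ Pu) (hv : 0 ≤ Pv)
    (h₁ h₂ Bu Bv : Vec) :
    ∃ α₀ : ℝ, IsGreatest
      (Set.range fun α : ℝ => min (dpcRate N Pu Pv h₁ Bu Bv α) (dpcRate N Pu Pv h₂ Bu Bv α))
      (min (dpcRate N Pu Pv h₁ Bu Bv α₀) (dpcRate N Pu Pv h₂ Bu Bv α₀)) := by
  set b₁ := dpcBeta N Pu h₁ Bu Bv with hb₁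
  set b₂ := dpcBeta N Pu h₂ Bu Bv with hb₂
  obtain ⟨α₀, -, hmax⟩ := (isCompact_Icc (a := min b₁ b₂) (b := max b₁ b₂)).exists_isMaxOn
    ⟨b₁, min_le_left _ _, le_max_left _ _⟩
    ((dpcRate_continuous hN hu hv h₁ Bu Bv).min
      (dpcRate_continuous hN hu hv h₂ Bu Bv)).continuousOn
  refine ⟨α₀, ⟨α₀, rfl⟩, ?_⟩
  rintro _ ⟨α, rfl⟩
  have key : ∃ c ∈ Set.Icc (min b₁ b₂) (max b₁ b₂),
      (c - b₁) ^ 2 ≤ (α - b₁) ^ 2 ∧ (c - b₂) ^ 2 ≤ (α - b₂) ^ 2 := by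
    have hm1 := min_le_left b₁ b₂
    have hm2 := min_le_right b₁ b₂
    have hM1 := le_max_left b₁ b₂
    have hM2 := le_max_right b₁ b₂
    rcases lt_or_ge α (min b₁ b₂) with hlt | hge
    · exact ⟨min b₁ b₂, ⟨le_rfl, hm1.trans hM1⟩, by nlinarith, by nlinarith⟩
    · rcases lt_or_ge (max b₁ b₂) α with hlt | hle
      · exact ⟨max b₁ b₂, ⟨hm1.trans hM1, le_rfl⟩, by nlinarith, by nlinarith⟩
      · exact ⟨α, ⟨hge, hle⟩, le_rfl, le_rfl⟩
  obtain ⟨c, hc, h1, h2⟩ := key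
  exact (min_le_min (dpcRate_mono hN hu hv h₁ Bu Bv h1)
    (dpcRate_mono hN hu hv h₂ Bu Bv h2)).trans (hmax hc)

end CompoundMISO

end

namespace CompoundMISO

/-! Every region involved equals the union of `orthogonalRegion N P q` over `q ∈ [0, P]`. For the
outer bounds, `q` is read off from the rate of user 2. The rate constraints of user 1 over `h₁` and
`h₂` are then added: since `h₁, h₂` is an orthonormal basis, the components of a unit beam sum to
`1`, and the beam directions drop out except through `g`. For the converse, sending along the mean
channel and `g` in the second corner attains each `orthogonalRegion`, and so does the closed form at
`η = -1`. -/

/-- The rate pairs reached when user 2 sends along `g` with power `q` and user 1 uses the rest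
of the power along the mean channel. -/
def orthogonalRegion (N P q : ℝ) : Set (ℝ × ℝ) :=
  {R | 0 ≤ R.1 ∧ 0 ≤ R.2 ∧
    R.1 ≤ 1 / 2 * Real.logb 2 ((P + 2 * N) / (q + 2 * N)) ∧
    R.2 ≤ 1 / 2 * Real.logb 2 ((q + N) / N)}

theorem le_half_logb_iff {R X : ℝ} (hX : 0 < X) :
    R ≤ 1 / 2 * Real.logb 2 X ↔ (2 : ℝ) ^ (2 * R) ≤ X := by
  rw [← Real.le_logb_iff_rpow_le (by norm_num) hX]
  constructor <;> intro h <;> linarith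

/-! ### Geometry of the channel vectors. -/

section Channels

variable {h₁ h₂ g : Vec}

theorem inner_eq_of_orthonormal (hh₁ : ‖h₁‖ = 1) (hh₂ : ‖h₂‖ = 1) (horth : inner ℝ h₁ h₂ = 0)
    (x y : Vec) :
    inner ℝ x y = inner ℝ h₁ x * inner ℝ h₁ y + inner ℝ h₂ x * inner ℝ h₂ y := by
  have horth' : inner ℝ h₂ h₁ = 0 := by rw [real_inner_comm]; exact horth
  have ho : Orthonormal ℝ ![h₁, h₂] := by
    refine ⟨fun i => by fin_cases i <;> simpa, fun i j hij => ?_⟩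
    fin_cases i <;> fin_cases j <;> simp_all
  let b₀ := basisOfOrthonormalOfCardEqFinrank ho (by simp)
  have hb : Orthonormal ℝ b₀ := by
    rw [coe_basisOfOrthonormalOfCardEqFinrank]; exact ho
  let b := b₀.toOrthonormalBasis hb
  have hbc : ⇑b = ![h₁, h₂] := by simp [b, b₀]
  have := b.sum_inner_mul_inner x y
  rw [← this, Fin.sum_univ_two, hbc]
  simp [real_inner_comm]

theorem inner_sq_add_inner_sq (hh₁ : ‖h₁‖ = 1) (hh₂ : ‖h₂‖ = 1) (horth : inner ℝ h₁ h₂ = 0)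
    {x : Vec} (hx : ‖x‖ = 1) : (inner ℝ h₁ x) ^ 2 + (inner ℝ h₂ x) ^ 2 = 1 := by
  have h := inner_eq_of_orthonormal hh₁ hh₂ horth x x
  rw [real_inner_self_eq_norm_sq, hx] at h
  linarith

theorem inner_add_inner_eq_zero (hgm : inner ℝ g (meanChannel h₁ h₂) = 0) :
    inner ℝ h₁ g + inner ℝ h₂ g = 0 := by
  unfold meanChannel at hgm
  rw [inner_smul_right, inner_add_right] at hgm
  have : (1 / Real.sqrt 2) ≠ 0 := by positivity
  rw [real_inner_comm g h₁, real_inner_comm g h₂]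
  exact (mul_eq_zero.mp hgm).resolve_left this

theorem inner_g_sq (hh₁ : ‖h₁‖ = 1) (hh₂ : ‖h₂‖ = 1) (horth : inner ℝ h₁ h₂ = 0)
    (hg : ‖g‖ = 1) (hgm : inner ℝ g (meanChannel h₁ h₂) = 0) :
    (inner ℝ h₁ g) ^ 2 = 1 / 2 ∧ (inner ℝ h₂ g) ^ 2 = 1 / 2 := by
  have h1 := inner_sq_add_inner_sq hh₁ hh₂ horth hg
  have h2 : inner ℝ h₂ g = -inner ℝ h₁ g := by linarith [inner_add_inner_eq_zero hgm]
  rw [h2] at h1 ⊢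
  constructor <;> nlinarith

theorem inner_meanChannel_sq (hh₁ : ‖h₁‖ = 1) (hh₂ : ‖h₂‖ = 1) (horth : inner ℝ h₁ h₂ = 0) :
    (inner ℝ h₁ (meanChannel h₁ h₂)) ^ 2 = 1 / 2 ∧
      (inner ℝ h₂ (meanChannel h₁ h₂)) ^ 2 = 1 / 2 := by
  have horth' : inner ℝ h₂ h₁ = 0 := by rw [real_inner_comm]; exact horth
  constructor <;>
  simp [meanChannel, inner_smul_right, inner_add_right, horth, horth', hh₁, hh₂]

theorem norm_meanChannel (hh₁ : ‖h₁‖ = 1) (hh₂ : ‖h₂‖ = 1) (horth : inner ℝ h₁ h₂ = 0) :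
    ‖meanChannel h₁ h₂‖ = 1 := by
  have h := inner_eq_of_orthonormal hh₁ hh₂ horth (meanChannel h₁ h₂) (meanChannel h₁ h₂)
  obtain ⟨h1, h2⟩ := inner_meanChannel_sq hh₁ hh₂ horth
  rw [real_inner_self_eq_norm_sq] at h
  have : ‖meanChannel h₁ h₂‖ ^ 2 = 1 := by linarith
  nlinarith [norm_nonneg (meanChannel h₁ h₂)]

/-- The channel of user 2 sees the difference of the two components seen by user 1. -/
theorem sub_smul_inner_g_sq_le (hh₁ : ‖h₁‖ = 1) (hh₂ : ‖h₂‖ = 1) (horth : inner ℝ h₁ h₂ = 0)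
    (hg : ‖g‖ = 1) (x y : Vec) (α : ℝ) :
    (inner ℝ g x - α * inner ℝ g y) ^ 2 ≤
      (inner ℝ h₁ x - α * inner ℝ h₁ y) ^ 2 + (inner ℝ h₂ x - α * inner ℝ h₂ y) ^ 2 := by
  have h := inner_eq_of_orthonormal hh₁ hh₂ horth (x - α • y) (x - α • y)
  have hc := real_inner_mul_inner_self_le g (x - α • y)
  rw [real_inner_self_eq_norm_sq g, hg] at hc
  simp only [inner_sub_right (𝕜 := ℝ), real_inner_smul_right] at h hc
  nlinarith

end Channels

/-! ### Outer bounds for the two corner regions. -/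

/-- Undoing the completed square in `α` exposes the residual `h_v - α h_u`, which is linear in the
channel, so the two channels can be added. -/
theorem dpcRate_denominator {N Pu Pv : ℝ} (hN : 0 < N) (hu : 0 < Pu) (hv : 0 ≤ Pv)
    (h Bu Bv : Vec) (α : ℝ) :
    dpcI N Pu Pv h Bu Bv * (α - dpcBeta N Pu h Bu Bv) ^ 2 + N =
      ((inner ℝ h Bu) ^ 2 * Pu + N) /
          ((inner ℝ h Bu) ^ 2 * Pu + (inner ℝ h Bv) ^ 2 * Pv + N) *
        (Pv * (inner ℝ h Bv - α * inner ℝ h Bu) ^ 2 + N * α ^ 2 * Pv / Pu + N) := by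
  unfold dpcI dpcBeta
  have h1 : (inner ℝ h Bu) ^ 2 * Pu + N ≠ 0 := by positivity
  have h2 : (inner ℝ h Bu) ^ 2 * Pu + (inner ℝ h Bv) ^ 2 * Pv + N ≠ 0 := by positivity
  generalize inner ℝ h Bu = a at *
  generalize inner ℝ h Bv = b at *
  field_simp
  ring

theorem rpow_mul_le_of_le_dpcRate {N Pu Pv R : ℝ} (hN : 0 < N) (hu : 0 < Pu) (hv : 0 ≤ Pv)
    {h Bu Bv : Vec} {α : ℝ} (hR : R ≤ dpcRate N Pu Pv h Bu Bv α) :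
    (2 : ℝ) ^ (2 * R) *
        (Pv * (inner ℝ h Bv - α * inner ℝ h Bu) ^ 2 + N * α ^ 2 * Pv / Pu + N) ≤
      (inner ℝ h Bu) ^ 2 * Pu + (inner ℝ h Bv) ^ 2 * Pv + N := by
  have h1 : 0 < (inner ℝ h Bu) ^ 2 * Pu + N := by positivity
  have h2 : 0 < (inner ℝ h Bu) ^ 2 * Pu + (inner ℝ h Bv) ^ 2 * Pv + N := by positivity
  have h3 : 0 < Pv * (inner ℝ h Bv - α * inner ℝ h Bu) ^ 2 + N * α ^ 2 * Pv / Pu + N := by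
    positivity
  unfold dpcRate at hR
  rw [dpcRate_denominator hN hu hv, le_half_logb_iff (by positivity)] at hR
  rw [← le_div_iff₀ h3]
  refine hR.trans_eq ?_
  field_simp

/-- The squared residuals over `h₁` and `h₂` add up to at least the one seen by `g`. Minimizing the
resulting quadratic over `α` gives a bound free of `α`. -/
theorem le_half_logb_of_le_min_dpcRate {h₁ h₂ g Bu Bv : Vec} {N P Pu Pv R α : ℝ} (hN : 0 < N)
    (hh₁ : ‖h₁‖ = 1) (hh₂ : ‖h₂‖ = 1) (horth : inner ℝ h₁ h₂ = 0) (hg : ‖g‖ = 1)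
    (hu : 0 ≤ Pu) (hv : 0 ≤ Pv) (hP : Pu + Pv ≤ P) (hBu : ‖Bu‖ = 1) (hBv : ‖Bv‖ = 1)
    (hq : N * ((inner ℝ g Bv) ^ 2 * Pv) / ((inner ℝ g Bu) ^ 2 * Pu + N) ≤ P)
    (hR₁ : R ≤ dpcRate N Pu Pv h₁ Bu Bv α) (hR₂ : R ≤ dpcRate N Pu Pv h₂ Bu Bv α) :
    R ≤ 1 / 2 * Real.logb 2 ((P + 2 * N) /
      (N * ((inner ℝ g Bv) ^ 2 * Pv) / ((inner ℝ g Bu) ^ 2 * Pu + N) + 2 * N)) := by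
  have hgu : 0 < (inner ℝ g Bu) ^ 2 * Pu + N := by positivity
  have hq0 : 0 ≤ N * ((inner ℝ g Bv) ^ 2 * Pv) / ((inner ℝ g Bu) ^ 2 * Pu + N) := by positivity
  rw [le_half_logb_iff (by apply div_pos <;> linarith), le_div_iff₀ (by positivity)]
  have hT : 0 < (2 : ℝ) ^ (2 * R) := by positivity
  -- With `Pu = 0` the rate is `0`, and `hq` alone suffices.
  rcases hu.eq_or_lt with rfl | hu
  · have hle : (2 : ℝ) ^ (2 * R) ≤ 1 := by
      have : dpcRate N 0 Pv h₁ Bu Bv α = 0 := by simp [dpcRate, dpcI, hN.ne']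
      rw [this] at hR₁
      exact Real.rpow_le_one_of_one_le_of_nonpos (by norm_num) (by linarith)
    nlinarith
  · have e1 := rpow_mul_le_of_le_dpcRate hN hu hv hR₁
    have e2 := rpow_mul_le_of_le_dpcRate hN hu hv hR₂
    have hsu := inner_sq_add_inner_sq hh₁ hh₂ horth hBu
    have hsv := inner_sq_add_inner_sq hh₁ hh₂ horth hBv
    have hc := mul_le_mul_of_nonneg_left
      (sub_smul_inner_g_sq_le hh₁ hh₂ horth hg Bv Bu α) hv
    -- The sum contains this term twice; `hmin` uses one copy and the other is dropped.
    have hn : 0 ≤ N * α ^ 2 * Pv / Pu := by positivity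
    have hmin : N * ((inner ℝ g Bv) ^ 2 * Pv) / ((inner ℝ g Bu) ^ 2 * Pu + N) ≤
        Pv * (inner ℝ g Bv - α * inner ℝ g Bu) ^ 2 + N * α ^ 2 * Pv / Pu := by
      rw [div_le_iff₀ hgu, ← sub_nonneg]
      generalize inner ℝ g Bu = a
      generalize inner ℝ g Bv = b
      -- The square vanishes at the minimizer `α = a b Pu / (a² Pu + N)`.
      have : (Pv * (b - α * a) ^ 2 + N * α ^ 2 * Pv / Pu) * (a ^ 2 * Pu + N) - N * (b ^ 2 * Pv) =
          Pv / Pu * (a * Pu * (b - α * a) - N * α) ^ 2 := by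
        field_simp
        ring
      rw [this]
      positivity
    have hsum : (2 : ℝ) ^ (2 * R) *
        (N * ((inner ℝ g Bv) ^ 2 * Pv) / ((inner ℝ g Bu) ^ 2 * Pu + N) + 2 * N) ≤
        (2 : ℝ) ^ (2 * R) *
          ((Pv * (inner ℝ h₁ Bv - α * inner ℝ h₁ Bu) ^ 2 + N * α ^ 2 * Pv / Pu + N) +
           (Pv * (inner ℝ h₂ Bv - α * inner ℝ h₂ Bu) ^ 2 + N * α ^ 2 * Pv / Pu + N)) :=
      mul_le_mul_of_nonneg_left (by linarith) hT.le
    have hpow : ((inner ℝ h₁ Bu) ^ 2 * Pu + (inner ℝ h₁ Bv) ^ 2 * Pv + N) +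
        ((inner ℝ h₂ Bu) ^ 2 * Pu + (inner ℝ h₂ Bv) ^ 2 * Pv + N) = Pu + Pv + 2 * N := by
      linear_combination Pu * hsu + Pv * hsv
    linarith

theorem inner_sq_le_one {x y : Vec} (hx : ‖x‖ = 1) (hy : ‖y‖ = 1) : (inner ℝ x y) ^ 2 ≤ 1 := by
  have h := abs_real_inner_le_norm x y
  rw [hx, hy, mul_one] at h
  exact (sq_le_one_iff_abs_le_one _).2 h

theorem exists_orthogonalRegion_of_mem_regionOne {h₁ h₂ g Bu Bv : Vec} {N P Pu Pv : ℝ}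
    (hN : 0 < N) (hh₁ : ‖h₁‖ = 1) (hh₂ : ‖h₂‖ = 1) (horth : inner ℝ h₁ h₂ = 0) (hg : ‖g‖ = 1)
    (hu : 0 ≤ Pu) (hv : 0 ≤ Pv) (hP : Pu + Pv ≤ P) (hBu : ‖Bu‖ = 1) (hBv : ‖Bv‖ = 1)
    {R : ℝ × ℝ} (hR : R ∈ regionOne h₁ h₂ g N Bu Bv Pu Pv) :
    ∃ q ∈ Set.Icc 0 P, R ∈ orthogonalRegion N P q := by
  obtain ⟨h0, h0', hR₁, hR₂⟩ := hR
  obtain ⟨α, hα⟩ := exists_max_dpcRate hN hu hv h₁ h₂ Bu Bv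
  -- The supremum is attained, so a single `α` serves both channels.
  rw [iSup, hα.csSup_eq] at hR₁
  have hgu : 0 < (inner ℝ g Bu) ^ 2 * Pu + N := by positivity
  have hqP : N * ((inner ℝ g Bv) ^ 2 * Pv) / ((inner ℝ g Bu) ^ 2 * Pu + N) ≤ P := by
    rw [div_le_iff₀ hgu]
    have h1 : (inner ℝ g Bv) ^ 2 * Pv ≤ P := by
      nlinarith [mul_le_mul_of_nonneg_right (inner_sq_le_one hg hBv) hv]
    have h2 : 0 ≤ (inner ℝ g Bu) ^ 2 * Pu := by positivity
    nlinarith [mul_nonneg (by linarith : 0 ≤ P) h2]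
  -- Here `q = N g_v² Pv / (g_u² Pu + N)`, chosen so that `(q + N) / N` is exactly the ratio in the
  -- rate of user 2.
  refine ⟨_, ⟨by positivity, hqP⟩, h0, h0',
    le_half_logb_of_le_min_dpcRate hN hh₁ hh₂ horth hg hu hv hP hBu hBv hqP
      (hR₁.trans (min_le_left _ _)) (hR₁.trans (min_le_right _ _)), hR₂.trans_eq ?_⟩
  congr 2
  field_simp
  ring

theorem exists_orthogonalRegion_of_mem_regionTwo {h₁ h₂ g Bu Bv : Vec} {N P Pu Pv : ℝ}
    (hN : 0 < N) (hh₁ : ‖h₁‖ = 1) (hh₂ : ‖h₂‖ = 1) (horth : inner ℝ h₁ h₂ = 0) (hg : ‖g‖ = 1)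
    (hu : 0 ≤ Pu) (hv : 0 ≤ Pv) (hP : Pu + Pv ≤ P) (hBu : ‖Bu‖ = 1) (hBv : ‖Bv‖ = 1)
    {R : ℝ × ℝ} (hR : R ∈ regionTwo h₁ h₂ g N Bu Bv Pu Pv) :
    ∃ q ∈ Set.Icc 0 P, R ∈ orthogonalRegion N P q := by
  obtain ⟨h0, h0', hR₁, hR₂⟩ := hR
  have hqv : (inner ℝ g Bv) ^ 2 * Pv ≤ Pv := mul_le_of_le_one_left hv (inner_sq_le_one hg hBv)
  have hq0 : 0 ≤ (inner ℝ g Bv) ^ 2 * Pv := by positivity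
  refine ⟨_, ⟨hq0, by linarith⟩, h0, h0', ?_, hR₂⟩
  have e1 := hR₁.trans (min_le_left _ _)
  have e2 := hR₁.trans (min_le_right _ _)
  unfold interferedRate at e1 e2
  rw [le_half_logb_iff (by positivity), le_div_iff₀ (by positivity)] at e1 e2
  rw [le_half_logb_iff (by apply div_pos <;> linarith), le_div_iff₀ (by positivity)]
  have hsu := inner_sq_add_inner_sq hh₁ hh₂ horth hBu
  have hsv := inner_sq_add_inner_sq hh₁ hh₂ horth hBv
  have hT : 0 < (2 : ℝ) ^ (2 * R.1) := by positivity
  -- Sum of the two channel constraints; `q = g_v² Pv ≤ Pv` then weakens it to the goal.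
  have hsum : (2 : ℝ) ^ (2 * R.1) * (Pv + 2 * N) ≤ Pu + Pv + 2 * N := by
    linear_combination e1 + e2 + Pu * hsu + (Pv - (2 : ℝ) ^ (2 * R.1) * Pv) * hsv
  linarith [mul_le_mul_of_nonneg_left hqv hT.le]

/-! ### Comparison with the closed form. -/

/-- Take `q = (1 - η) Pv / 2`. As `η² ≤ 1`, the root is at most `P + 2N`, so `Peta ≥ q Pu / (P +
2N)`; the rate bound then reduces to `Pu + q ≤ P`. -/
theorem exists_orthogonalRegion_of_mem_closedRegion {N P Pu Pv η : ℝ} (hN : 0 < N)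
    (hu : 0 ≤ Pu) (hv : 0 ≤ Pv) (hP : Pu + Pv ≤ P) (hη : η ∈ Set.Icc (-1 : ℝ) 1)
    {R : ℝ × ℝ} (hR : R ∈ closedRegion N P Pu Pv η) :
    ∃ q ∈ Set.Icc 0 P, R ∈ orthogonalRegion N P q := by
  obtain ⟨h0, h0', hR₁, hR₂⟩ := hR
  obtain ⟨hη₁, hη₂⟩ := hη
  have hq0 : 0 ≤ (1 - η) * Pv := mul_nonneg (by linarith) hv
  have hqv : (1 - η) * Pv / 2 ≤ Pv := by nlinarith
  have hS : 0 < P + 2 * N := by linarith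
  have hsqrt : Real.sqrt ((P + 2 * N) ^ 2 + (η ^ 2 - 1) * Pv ^ 2) ≤ P + 2 * N := by
    refine Real.sqrt_le_iff.2 ⟨hS.le, ?_⟩
    have : (η ^ 2 - 1) * Pv ^ 2 ≤ 0 := mul_nonpos_of_nonpos_of_nonneg (by nlinarith) (sq_nonneg _)
    linarith
  have hη : (1 - η) * Pv / 2 * Pu / (P + 2 * N) ≤ Peta N P Pu Pv η := by
    unfold Peta
    have hnn := Real.sqrt_nonneg ((P + 2 * N) ^ 2 + (η ^ 2 - 1) * Pv ^ 2)
    have : (1 - η) * Pv / 2 * Pu / (P + 2 * N) = (1 - η) * Pv * Pu / (2 * (P + 2 * N)) := by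
      field_simp
    rw [this]
    exact div_le_div_of_nonneg_left (mul_nonneg hq0 hu) (by linarith) (by linarith)
  have hη0 : 0 ≤ (1 - η) * Pv / 2 * Pu / (P + 2 * N) := by positivity
  refine ⟨(1 - η) * Pv / 2, ⟨by linarith, by linarith⟩, h0, h0', ?_, hR₂.trans_eq ?_⟩
  · rw [le_half_logb_iff (by apply div_pos <;> linarith)] at hR₁ ⊢
    refine hR₁.trans ((div_le_div_of_nonneg_left (by linarith) (by linarith)
      (add_le_add_left hη _)).trans ?_)
    rw [div_le_div_iff₀ (by linarith) (by linarith)]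
    have : (P + 2 * N) * ((1 - η) * Pv / 2 * Pu / (P + 2 * N) + 2 * N) =
        (1 - η) * Pv / 2 * Pu + 2 * N * (P + 2 * N) := by
      field_simp
    rw [this]
    nlinarith
  · congr 2
    field_simp

/-- At `η = -1` the root is exactly `P + 2N`, so `Peta + 2N` factors and `P - q + 2N` cancels. -/
theorem orthogonalRegion_subset_closedRegion {N P q : ℝ} (hN : 0 < N) (hq : q ∈ Set.Icc 0 P) :
    orthogonalRegion N P q ⊆ closedRegion N P (P - q) q (-1) := by
  rintro R ⟨h0, h0', hR₁, hR₂⟩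
  obtain ⟨hq0, hqP⟩ := hq
  have hS : 0 < P + 2 * N := by linarith
  have hPeta : Peta N P (P - q) q (-1) + 2 * N =
      (q + 2 * N) * (P - q + 2 * N) / (P + 2 * N) := by
    unfold Peta
    norm_num
    rw [Real.sqrt_sq hS.le]
    field_simp
    ring
  refine ⟨h0, h0', hR₁.trans_eq ?_, hR₂.trans_eq ?_⟩
  · have h1 : P - q + 2 * N ≠ 0 := by linarith
    have h2 : q + 2 * N ≠ 0 := by linarith
    rw [hPeta]
    congr 2
    field_simp
  · congr 2
    field_simp
    ring

/-- Both beams have squared component `1/2` along each `h_j`, so the two channels of user 1 give the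
same rate and the minimum loses nothing. -/
theorem orthogonalRegion_subset_regionTwo {h₁ h₂ g : Vec} {N P q : ℝ} (hN : 0 < N)
    (hh₁ : ‖h₁‖ = 1) (hh₂ : ‖h₂‖ = 1) (horth : inner ℝ h₁ h₂ = 0)
    (hg : ‖g‖ = 1) (hgm : inner ℝ g (meanChannel h₁ h₂) = 0) (hq : q ∈ Set.Icc 0 P) :
    orthogonalRegion N P q ⊆ regionTwo h₁ h₂ g N (meanChannel h₁ h₂) g (P - q) q := by
  rintro R ⟨h0, h0', hR₁, hR₂⟩
  obtain ⟨hq0, hqP⟩ := hq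
  obtain ⟨g1, g2⟩ := inner_g_sq hh₁ hh₂ horth hg hgm
  obtain ⟨m1, m2⟩ := inner_meanChannel_sq hh₁ hh₂ horth
  have hX : (P + 2 * N) / (q + 2 * N) =
      (1 / 2 * (P - q) + 1 / 2 * q + N) / (1 / 2 * q + N) := by
    have h2 : q + 2 * N ≠ 0 := by linarith
    have h3 : 1 / 2 * q + N ≠ 0 := by linarith
    field_simp
    ring
  rw [hX] at hR₁
  refine ⟨h0, h0', ?_, ?_⟩
  · unfold interferedRate
    rw [g1, g2, m1, m2, min_self]
    exact hR₁
  · rw [real_inner_self_eq_norm_sq, hg]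
    simpa using hR₂

end CompoundMISO

open CompoundMISO in
theorem mainTheorem10 (h₁ h₂ g : EuclideanSpace ℝ (Fin 2)) (N P : ℝ) (hN : 0 < N) (hP : 0 ≤ P)
    (hh₁ : ‖h₁‖ = 1) (hh₂ : ‖h₂‖ = 1) (horth : inner ℝ h₁ h₂ = 0)
    (hg : ‖g‖ = 1) (hgm : inner ℝ g (CompoundMISO.meanChannel h₁ h₂) = 0) :
    CompoundMISO.cdRegion h₁ h₂ g N P =
        {R | ∃ Pu Pv : ℝ, 0 ≤ Pu ∧ 0 ≤ Pv ∧ Pu + Pv ≤ P ∧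
          ∃ η ∈ Set.Icc (-1 : ℝ) 1, R ∈ CompoundMISO.closedRegion N P Pu Pv η} ∧
    CompoundMISO.cdRegion h₁ h₂ g N P =
        {R | ∃ Pu Pv : ℝ, 0 ≤ Pu ∧ 0 ≤ Pv ∧ Pu + Pv = P ∧
          ∃ η ∈ Set.Icc (-1 : ℝ) 1, R ∈ CompoundMISO.closedRegion N P Pu Pv η} ∧
    CompoundMISO.cdRegion h₁ h₂ g N P =
        CompoundMISO.cdRegionAlong h₁ h₂ g N P (CompoundMISO.meanChannel h₁ h₂) := by
  have cd_sub : ∀ R ∈ cdRegion h₁ h₂ g N P, ∃ q ∈ Set.Icc 0 P, R ∈ orthogonalRegion N P q := by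
    rintro R ⟨Pu, Pv, hu, hv, hPuv, Bu, Bv, hBu, hBv, hR | hR⟩
    · exact exists_orthogonalRegion_of_mem_regionOne hN hh₁ hh₂ horth hg hu hv hPuv hBu hBv hR
    · exact exists_orthogonalRegion_of_mem_regionTwo hN hh₁ hh₂ horth hg hu hv hPuv hBu hBv hR
  have sub_along : ∀ q ∈ Set.Icc 0 P, ∀ R ∈ orthogonalRegion N P q,
      R ∈ cdRegionAlong h₁ h₂ g N P (meanChannel h₁ h₂) := fun q hq R hR =>
    ⟨P - q, q, by linarith [hq.2], hq.1, by linarith, g, hg,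
      Or.inr (orthogonalRegion_subset_regionTwo hN hh₁ hh₂ horth hg hgm hq hR)⟩
  have along_sub : ∀ R ∈ cdRegionAlong h₁ h₂ g N P (meanChannel h₁ h₂),
      R ∈ cdRegion h₁ h₂ g N P := by
    rintro R ⟨Pu, Pv, hu, hv, hPuv, Bv, hBv, hR⟩
    exact ⟨Pu, Pv, hu, hv, hPuv, _, Bv, norm_meanChannel hh₁ hh₂ horth, hBv, hR⟩
  have sub_closed : ∀ q ∈ Set.Icc 0 P, ∀ R ∈ orthogonalRegion N P q,
      ∃ Pu Pv : ℝ, 0 ≤ Pu ∧ 0 ≤ Pv ∧ Pu + Pv = P ∧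
        ∃ η ∈ Set.Icc (-1 : ℝ) 1, R ∈ closedRegion N P Pu Pv η := fun q hq R hR =>
    ⟨P - q, q, by linarith [hq.2], hq.1, by ring, -1, by norm_num,
      orthogonalRegion_subset_closedRegion hN hq hR⟩
  have closed_sub : ∀ R, (∃ Pu Pv : ℝ, 0 ≤ Pu ∧ 0 ≤ Pv ∧ Pu + Pv ≤ P ∧
      ∃ η ∈ Set.Icc (-1 : ℝ) 1, R ∈ closedRegion N P Pu Pv η) → R ∈ cdRegion h₁ h₂ g N P := by
    rintro R ⟨Pu, Pv, hu, hv, hPuv, η, hη, hR⟩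
    obtain ⟨q, hq, hR⟩ := exists_orthogonalRegion_of_mem_closedRegion hN hu hv hPuv hη hR
    exact along_sub R (sub_along q hq R hR)
  refine ⟨Set.Subset.antisymm (fun R hR => ?_) closed_sub,
    Set.Subset.antisymm (fun R hR => ?_) ?_,
    Set.Subset.antisymm (fun R hR => ?_) along_sub⟩
  · obtain ⟨q, hq, hR⟩ := cd_sub R hR
    obtain ⟨Pu, Pv, hu, hv, hPuv, h⟩ := sub_closed q hq R hR
    exact ⟨Pu, Pv, hu, hv, hPuv.le, h⟩
  · obtain ⟨q, hq, hR⟩ := cd_sub R hR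
    exact sub_closed q hq R hR
  · rintro R ⟨Pu, Pv, hu, hv, hPuv, h⟩
    exact closed_sub R ⟨Pu, Pv, hu, hv, hPuv.le, h⟩
  · obtain ⟨q, hq, hR⟩ := cd_sub R hR
    exact sub_along q hq R hR
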